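/- Let $H$ be a complex Hilbert space with a fixed orthonormal basis $\{e_n\}_{n\ge 1}$ (so $H$ is separable and infinite-dimensional). Let $\mathcal D$ be the algebra of bounded operators on $H$ that are diagonal with respect to $\{e_n\}$, let $\mathcal K$ be the ideal of compact operators on $H$, and let $\mathcal D+\mathcal K=\{D+K: D\in\mathcal D,\ K\in\mathcal K\}$. For orthogonal projections $P,Q$ on $H$ such that the operator $QP|_{R(P)}:R(P)\to R(Q)$ is Fredholm, let $\mathrm{index}(P,Q)$ denote its Fredholm index, that is, the dimension of its kernel minus the dimension of its cokernel. Let $P\in\mathcal D+\mathcal K$ be an orthogonal projection. Then there exists an orthogonal projection $E_0\in\mathcal D$ such that $P-E_0\in\mathcal K$, the operator $E_0P|_{R(P)}:R(P)\to R(E_0)$ is Fredholm, and $\mathrm{index}(P,E_0)=0$. Moreover, there exists a unitary operator $U$ on $H$ such that $U-I\in\mathcal K$ and $U=e^{iX}$ for some $X=X^*\in\mathcal K$ with $\|X\|\le\pi$ (in particular, $U\in\mathcal D+\mathcal K$), which satisfies $UE_0U^*=P$. -/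

import Mathlib

open scoped Real

namespace DiagPlusCompact

variable {H : Type*} [NormedAddCommGroup H] [InnerProductSpace ℂ H]

/-- The bounded operator `D` is diagonal with respect to the orthonormal basis `e`:
`D e_n = x_n e_n` for some sequence `x` of scalars (automatically bounded, as `D` is). -/
def IsDiagonal (e : HilbertBasis ℕ ℂ H) (D : H →L[ℂ] H) : Prop :=
  ∃ x : ℕ → ℂ, ∀ n, D (e n) = x n • e n

/-- The algebra `𝒟 + 𝒦` of all sums of a diagonal operator and a compact operator. -/
def diagAddCompact (e : HilbertBasis ℕ ℂ H) : Set (H →L[ℂ] H) :=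
  {T | ∃ D K : H →L[ℂ] H, IsDiagonal e D ∧ IsCompactOperator K ∧ T = D + K}

/-- The Fredholm index `dim ker u - dim coker u` of an operator; meaningful when `u` is
Fredholm (`ContinuousLinearMap.IsFredholm`). -/
noncomputable def fredholmIndex {E F : Type*} [NormedAddCommGroup E] [NormedSpace ℂ E]
    [NormedAddCommGroup F] [NormedSpace ℂ F] (u : E →L[ℂ] F) : ℤ :=
  (Module.finrank ℂ u.ker : ℤ) - (Module.finrank ℂ (F ⧸ u.range) : ℤ)

/-- The operator `Q P|_{R(P)} : R(P) → R(Q)` attached to a pair `(P, Q)`. -/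
noncomputable def pairOperator (P Q : H →L[ℂ] H) : P.range →L[ℂ] Q.range :=
  ((Q ∘L P) ∘L P.range.subtypeL).codRestrict Q.range
    (fun x => LinearMap.mem_range_self (Q : H →ₗ[ℂ] H) (P (x : H)))

/-- `(P, Q)` is a Fredholm pair of projections: `Q P|_{R(P)} : R(P) → R(Q)` is Fredholm. -/
def IsFredholmPair (P Q : H →L[ℂ] H) : Prop :=
  (pairOperator P Q).IsFredholm

/-- The index of the pair of projections `(P, Q)`: the Fredholm index of
`Q P|_{R(P)} : R(P) → R(Q)`. -/
noncomputable def pairIndex (P Q : H →L[ℂ] H) : ℤ :=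
  fredholmIndex (pairOperator P Q)

end DiagPlusCompact

/-! Write `P = D + K`. Idempotency makes `D - D²` compact, so rounding the entries of `D` to 0 or 1
gives a diagonal projection `E` with `P - E` compact (`exists_isCompactOperator_sub_coordProj`).
Then `N(P) ∩ R(E)` and `R(P) ∩ N(E)` are eigenspaces of `P - E` at -1 and 1, hence
finite-dimensional, and changing finitely many indices kills both (`exists_coordProj_generic`).

In this general position the unitary `V = (2P - 1)(2E - 1)`, a compact perturbation of 1, omits -1
from its spectrum (`neg_one_notMem_spectrum`). Two consequences follow. First, `P + E - 1` is
invertible, so the pair operator is bijective and has index 0. Second, `V = exp(iY)` with `Y = arg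
V` compact, and the square root `U = exp(iY/2)` conjugates `E` to `P` (`conj_exp_half_cfc_arg`). -/

namespace DiagPlusCompact

section Projections

open NormedSpace Complex

/-! ### Compactness of exponentials and of the argument of a unitary -/

section Compact

variable {E : Type*} [NormedAddCommGroup E] [NormedSpace ℂ E]

theorem _root_.IsCompactOperator.mul_clm {K : E →L[ℂ] E} (hK : IsCompactOperator K)
    (T : E →L[ℂ] E) : IsCompactOperator (K * T : E →L[ℂ] E) :=
  hK.comp_clm T

theorem _root_.IsCompactOperator.smul_clm {K : E →L[ℂ] E} (hK : IsCompactOperator K)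
    (c : ℂ) : IsCompactOperator (c • K : E →L[ℂ] E) :=
  hK.smul c

theorem isCompactOperator_exp_sub_one [CompleteSpace E] {K : E →L[ℂ] E}
    (hK : IsCompactOperator K) : IsCompactOperator (exp K - 1 : E →L[ℂ] E) := by
  -- Dropping the constant term leaves a series of compact operators, and norm limits of compact
  -- operators are compact.
  have h := (hasSum_nat_add_iff' 1).mpr (exp_series_hasSum_exp' (𝕂 := ℂ) K)
  refine isCompactOperator_of_tendsto (l := Filter.atTop) (by simpa [HasSum] using h) (.of_forall fun s => ?_)
  have hmem : ∀ n : ℕ, (((n + 1).factorial : ℂ)⁻¹ • K ^ (n + 1)) ∈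
      compactOperator (RingHom.id ℂ) E E := fun n =>
    Submodule.smul_mem _ _ (by
      change IsCompactOperator (K ^ (n + 1) : E →L[ℂ] E)
      rw [pow_succ']
      exact hK.mul_clm _)
  exact Submodule.sum_mem _ fun n _ => hmem n

end Compact

variable {H : Type*} [NormedAddCommGroup H] [InnerProductSpace ℂ H] [CompleteSpace H]

/-- On the unit circle `arg z = -i log z`, which vanishes at 1. Hence it factors as `(z - 1) g(z)`
with `g` continuous on the slit plane, and the compact factor `V - 1` splits off. -/
theorem isCompactOperator_cfc_arg {V : H →L[ℂ] H} (hV : V ∈ unitary (H →L[ℂ] H))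
    (hV1 : IsCompactOperator (V - 1 : H →L[ℂ] H)) (hs : spectrum ℂ V ⊆ slitPlane) :
    IsCompactOperator (cfc (fun z : ℂ => (arg z : ℂ)) V : H →L[ℂ] H) := by
  have hn : IsStarNormal V := isStarNormal_of_mem_unitary hV
  have hd : ContinuousOn (fun z => -I * dslope log 1 z) (spectrum ℂ V) := by
    refine continuousOn_const.mul (ContinuousOn.mono ?_ hs)
    rw [continuousOn_dslope (isOpen_slitPlane.mem_nhds one_mem_slitPlane)]
    exact ⟨fun z hz => (continuousAt_clog hz).continuousWithinAt,
      (hasDerivAt_log one_mem_slitPlane).differentiableAt⟩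
  have h : cfc (fun z : ℂ => (arg z : ℂ)) V =
      (V - 1) * cfc (fun z => -I * dslope log 1 z) V := by
    have h1 : V - 1 = cfc (fun z : ℂ => z - 1) V := by
      rw [cfc_sub .., cfc_id' ℂ V, cfc_const_one ℂ V]
    rw [h1, ← cfc_mul (fun z : ℂ => z - 1) _ V (by fun_prop) hd]
    refine cfc_congr fun z hz => ?_
    have hz1 : ‖z‖ = 1 := spectrum.norm_eq_one_of_unitary hV hz
    have hlog : log z = I * arg z := by
      apply Complex.ext <;> simp [log_re, log_im, hz1]
    have := sub_smul_dslope log 1 z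
    simp only [smul_eq_mul, log_one, sub_zero] at this
    change _ = (z - 1) * (-I * dslope log 1 z)
    rw [mul_left_comm, this, hlog, ← mul_assoc]
    simp
  rw [h]
  exact hV1.mul_clm _

/-- If conjugation by a unitary `R` inverts the unitary `V`, it negates the argument of `V`. -/
theorem conj_cfc_arg {A : Type*} [CStarAlgebra A] {V : A} (hV : V ∈ unitary A)
    (hs : spectrum ℂ V ⊆ slitPlane) (R : unitary A) (hR : R * V * star (R : A) = star V) :
    (R : A) * cfc (fun z : ℂ => (arg z : ℂ)) V * star (R : A) =
      -cfc (fun z : ℂ => (arg z : ℂ)) V := by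
  have hn : IsStarNormal V := isStarNormal_of_mem_unitary hV
  have hc : ContinuousOn (fun z : ℂ => (arg z : ℂ)) slitPlane :=
    continuous_ofReal.comp_continuousOn continuousOn_arg
  have hφ : Unitary.conjStarAlgAut ℂ A R V = star V := hR
  have h1 := StarAlgHomClass.map_cfc (S := ℂ) (Unitary.conjStarAlgAut ℂ A R)
    (fun z : ℂ => (arg z : ℂ)) V (hc.mono hs)
    (by change Continuous fun x : A => (R : A) * x * star (R : A); fun_prop) hn
    (by rw [hφ]; infer_instance)
  rw [hφ, Unitary.conjStarAlgAut_apply] at h1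
  have hst : star '' spectrum ℂ V ⊆ slitPlane := by
    rintro _ ⟨z, hz, rfl⟩
    have := hs hz
    simpa [mem_slitPlane_iff] using this
  rw [h1, ← cfc_comp_star _ _ (hc.mono hst), ← cfc_neg]
  refine cfc_congr fun z hz => ?_
  -- Conjugation negates the argument except on the negative real axis.
  have : arg z ≠ π := (mem_slitPlane_iff_arg.1 (hs hz)).1
  simp [arg_conj, this]

/-! ### Reflections and the square root of their product -/

section Reflections

variable {A : Type*} [CStarAlgebra A] {P E : A}

theorem two_smul_sub_one_mul_self (hP : IsStarProjection P) :
    ((2 : ℂ) • P - 1) * ((2 : ℂ) • P - 1) = 1 := by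
  have : P * P = P := hP.isIdempotentElem
  simp only [sub_mul, mul_sub, smul_mul_assoc, mul_smul_comm, this, one_mul, mul_one]
  module

theorem star_two_smul_sub_one (hP : IsStarProjection P) :
    star ((2 : ℂ) • P - 1) = (2 : ℂ) • P - 1 := by
  have : star P = P := hP.isSelfAdjoint
  simp [this]

theorem two_smul_sub_one_mem_unitary (hP : IsStarProjection P) :
    (2 : ℂ) • P - 1 ∈ unitary A := by
  rw [Unitary.mem_iff, star_two_smul_sub_one hP]
  exact ⟨two_smul_sub_one_mul_self hP, two_smul_sub_one_mul_self hP⟩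

/-- Two projections whose reflections have product at distance less than `2` from `1` are
conjugate under the square root of this product. -/
theorem conj_exp_half_cfc_arg (hP : IsStarProjection P) (hE : IsStarProjection E) {V : A}
    (hVdef : V = ((2 : ℂ) • P - 1) * ((2 : ℂ) • E - 1)) (hs : spectrum ℂ V ⊆ slitPlane) {X U : A}
    (hX : X = (2⁻¹ : ℂ) • cfc (fun z : ℂ => (arg z : ℂ)) V) (hU : U = exp (I • X)) :
    IsSelfAdjoint X ∧ ‖X‖ ≤ π ∧ U ∈ unitary A ∧ U * E * star U = P := by
  have : NormedAlgebra ℚ A := .restrictScalars ℚ ℂ A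
  set S : A := (2 : ℂ) • P - 1 with hS
  set R : A := (2 : ℂ) • E - 1 with hRdef
  have hSS : S * S = 1 := two_smul_sub_one_mul_self hP
  have hRR : R * R = 1 := two_smul_sub_one_mul_self hE
  have hSs : star S = S := star_two_smul_sub_one hP
  have hRs : star R = R := star_two_smul_sub_one hE
  have hRu : R ∈ unitary A := two_smul_sub_one_mem_unitary hE
  have hV : V ∈ unitary A := hVdef ▸ mul_mem (two_smul_sub_one_mem_unitary hP) hRu
  have hRV : R * V * star R = star V := by
    rw [hVdef, star_mul, hRs, hSs]
    simp only [mul_assoc, hRR, mul_one]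
  have hlt : ‖V - 1‖ < 2 := (Unitary.spectrum_subset_slitPlane_iff_norm_lt_two hV).1 hs
  set Y : A := cfc (fun z : ℂ => (arg z : ℂ)) V with hY
  have hYsa : IsSelfAdjoint Y := IsSelfAdjoint.cfc_arg V
  have hYexp : exp (I • Y) = V :=
    congrArg Subtype.val (expUnitary_argSelfAdjoint (u := ⟨V, hV⟩) hlt)
  have hYn : ‖Y‖ ≤ π := Unitary.norm_argSelfAdjoint_le_pi (⟨V, hV⟩ : unitary A)
  have hXsa : IsSelfAdjoint X := by
    rw [isSelfAdjoint_iff, hX, star_smul, hYsa.star_eq]; simp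
  have hUu : U ∈ unitary A := hU ▸ (selfAdjoint.expUnitary ⟨X, hXsa⟩).2
  have hUU : U * U = V := by
    rw [hU, ← exp_add_of_commute (Commute.refl _), ← hYexp, hX]
    congr 1
    module
  have hRYR : R * Y * star R = -Y := conj_cfc_arg hV hs ⟨R, hRu⟩ hRV
  have hUstar : star U = exp (-(I • X)) := by
    rw [hU, star_exp, star_smul, hXsa.star_eq]; simp
  have hRUR : R * U * R = star U := by
    have h := exp_units_conj (⟨R, R, hRR, hRR⟩ : Aˣ) (I • X)
    simp only [Units.inv_mk, ← hU] at h
    rw [← h, hUstar]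
    congr 1
    rw [hRs] at hRYR
    rw [hX, smul_smul, mul_smul_comm, smul_mul_assoc, hRYR, smul_neg]
  refine ⟨hXsa, ?_, hUu, ?_⟩
  · rw [hX, norm_smul]
    have : ‖(2⁻¹ : ℂ)‖ = 2⁻¹ := by simp
    rw [this]
    linarith [Real.pi_pos]
  -- Since `U* = RUR`, the conjugate `URU*` equals `U²R = VR = S`.
  · have hURU : U * R * star U = S := by
      rw [← hRUR]
      calc U * R * (R * U * R) = U * (R * R) * U * R := by simp only [mul_assoc]
        _ = S * (R * R) := by rw [hRR, mul_one, hUU, hVdef, mul_assoc, hRR]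
        _ = S := by rw [hRR, mul_one]
    have hUs : U * star U = 1 := Unitary.mul_star_self_of_mem hUu
    rw [hRdef, hS, mul_sub, sub_mul, mul_one, hUs, mul_smul_comm, smul_mul_assoc] at hURU
    exact smul_right_injective A (two_ne_zero (α := ℂ)) (sub_left_injective hURU)

end Reflections

/-! ### Projections in general position -/

variable {P E : H →L[ℂ] H}

/-- By the Fredholm alternative for `V - 1` at -2, a spectral value -1 has an eigenvector `x`. Then
`Px + Ex = x`, so `Px` lies in `R(P) ∩ N(E)` and `Ex` in `R(E) ∩ N(P)`; both vanish. -/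
theorem neg_one_notMem_spectrum (hP : IsStarProjection P) (hE : IsStarProjection E)
    (hc : IsCompactOperator (P - E : H →L[ℂ] H))
    (h₁ : ∀ x, P x = x → E x = 0 → x = 0) (h₂ : ∀ x, E x = x → P x = 0 → x = 0) :
    IsCompactOperator (((2 : ℂ) • P - 1) * ((2 : ℂ) • E - 1) - 1 : H →L[ℂ] H) ∧
    (-1 : ℂ) ∉ spectrum ℂ (((2 : ℂ) • P - 1) * ((2 : ℂ) • E - 1) : H →L[ℂ] H) := by
  set S : H →L[ℂ] H := (2 : ℂ) • P - 1 with hS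
  set R : H →L[ℂ] H := (2 : ℂ) • E - 1 with hR
  have hRR : R * R = 1 := two_smul_sub_one_mul_self hE
  have hSS : S * S = 1 := two_smul_sub_one_mul_self hP
  have hPP : ∀ x, P (P x) = P x := fun x => congr($(hP.isIdempotentElem.eq) x)
  have hEE : ∀ x, E (E x) = E x := fun x => congr($(hE.isIdempotentElem.eq) x)
  have hV : S * R - 1 = (2 : ℂ) • ((P - E) * R) := by
    rw [← hRR, ← sub_mul, ← smul_mul_assoc]
    congr 1
    rw [hS, hR]
    module
  have hVc : IsCompactOperator (S * R - 1 : H →L[ℂ] H) := by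
    rw [hV]
    exact (hc.mul_clm R).smul (2 : ℂ)
  refine ⟨hVc, fun hmem => ?_⟩
  have hres : (-2 : ℂ) ∉ resolventSet ℂ (S * R - 1 : H →L[ℂ] H) := by
    have : (-2 : ℂ) ∈ spectrum ℂ (S * R - 1 : H →L[ℂ] H) := by
      have := spectrum.sub_singleton_eq (S * R) (1 : ℂ)
      rw [map_one] at this
      rw [← this]
      exact ⟨-1, hmem, 1, rfl, by norm_num⟩
    exact this
  obtain ⟨x, hx⟩ := ((hVc.hasEigenvalue_or_mem_resolventSet (by norm_num)).resolve_right
    hres).exists_hasEigenvector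
  have hx0 := hx.2
  have hx1 : S (R x) - x = (-2 : ℂ) • x := hx.apply_eq_smul
  have hSR : S (R x) = -x := by
    rw [sub_eq_iff_eq_add] at hx1
    rw [hx1]; module
  have hSx : R x = -S x := by
    have h := congr($hSS (R x))
    simp only [mul_apply_eq_comp, one_apply_eq_self, hSR, map_neg] at h
    exact h.symm
  have hsum : P x + E x = x := by
    simp only [hS, hR, sub_apply, smul_apply,
      one_apply_eq_self] at hSx
    have : (2 : ℂ) • (P x + E x) = (2 : ℂ) • x := by
      rw [smul_add, ← sub_eq_zero]
      rw [← sub_eq_zero] at hSx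
      rw [← hSx]; module
    exact smul_right_injective H (two_ne_zero (α := ℂ)) this
  have hEP : E (P x) = 0 := by
    have := congrArg E hsum
    rwa [map_add, hEE, add_eq_right] at this
  have hPE : P (E x) = 0 := by
    have := congrArg P hsum
    rwa [map_add, hPP, add_eq_left] at this
  apply hx0
  rw [← hsum, h₁ _ (hPP x) hEP, h₂ _ (hEE x) hPE, add_zero]

/-- Multiplying `V + 1` on the right by the reflection `2E - 1` gives `2(P + E - 1)`. -/
theorem isUnit_add_sub_one (hE : IsStarProjection E)
    (h : (-1 : ℂ) ∉ spectrum ℂ (((2 : ℂ) • P - 1) * ((2 : ℂ) • E - 1) : H →L[ℂ] H)) :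
    IsUnit (P + E - 1) := by
  rw [spectrum.notMem_iff, ← IsUnit.neg_iff] at h
  have hEu := isUnit_iff_exists.2
    ⟨_, two_smul_sub_one_mul_self hE, two_smul_sub_one_mul_self hE⟩
  have hEE := two_smul_sub_one_mul_self hE
  have key : -((algebraMap ℂ (H →L[ℂ] H)) (-1) - ((2 : ℂ) • P - 1) * ((2 : ℂ) • E - 1)) *
      ((2 : ℂ) • E - 1) = (2 : ℂ) • (P + E - 1) := by
    rw [neg_sub, sub_mul, mul_assoc, hEE, mul_one, map_neg, map_one]
    simp only [neg_mul, one_mul]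
    module
  have h2 := h.mul hEu
  rw [key] at h2
  simpa using (h2.smul (Units.mk0 (2⁻¹ : ℂ) (by norm_num)))

/-- On `R(P)` the pair operator agrees with the invertible `P + E - 1`. -/
theorem bijective_pairOperator (hP : IsStarProjection P) (hE : IsStarProjection E)
    (hu : IsUnit (P + E - 1)) : Function.Bijective (pairOperator P E) := by
  have hPP : ∀ x, P (P x) = P x := fun x => congr($(hP.isIdempotentElem.eq) x)
  have hEE : ∀ x, E (E x) = E x := fun x => congr($(hE.isIdempotentElem.eq) x)
  have hbij := ContinuousLinearMap.isUnit_iff_bijective.1 hu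
  have hT : ∀ x : P.range, ((pairOperator P E x : E.range) : H) = (P + E - 1) (x : H) := by
    rintro ⟨_, x, rfl⟩
    change E (P (P x)) = P (P x) + E (P x) - P x
    rw [hPP]; abel
  refine ⟨fun x y hxy => Subtype.ext (hbij.1 ?_), ?_⟩
  · rw [← hT, ← hT, hxy]
  · rintro ⟨_, y, rfl⟩
    obtain ⟨x, hx⟩ := hbij.2 (E y)
    have hx' : P x + E x - x = E y := hx
    -- Both `x` and `Px` are sent to `Ey` by `P + E - 1`, so injectivity puts the preimage in
    -- `R(P)`.
    have hPx : P x = x := by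
      apply hbij.1
      rw [hx]
      change P (P x) + E (P x) - P x = E y
      have := congrArg E hx'
      rw [map_sub, map_add, hEE, hEE] at this
      rw [hPP, ← this]; abel
    refine ⟨⟨x, x, hPx⟩, Subtype.ext ?_⟩
    rw [hT]
    exact hx

theorem isFredholmPair_of_bijective (hP : IsStarProjection P) (hE : IsStarProjection E)
    (h : Function.Bijective (pairOperator P E)) : IsFredholmPair P E ∧ pairIndex P E = 0 := by
  have : CompleteSpace P.range := (ContinuousLinearMap.IsIdempotentElem.isClosed_range hP.isIdempotentElem).completeSpace_coe
  have : CompleteSpace E.range := (ContinuousLinearMap.IsIdempotentElem.isClosed_range hE.isIdempotentElem).completeSpace_coe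
  have hk : (pairOperator P E).ker = ⊥ := LinearMap.ker_eq_bot.2 h.1
  have hr : (pairOperator P E).range = ⊤ := LinearMap.range_eq_top.2 h.2
  constructor
  · let e := ContinuousLinearEquiv.ofBijective (pairOperator P E) hk hr
    refine ⟨e.toHomeomorph.isEmbedding.isStrictMap, ?_, ?_, ?_, ?_⟩
    · rw [hr]; exact isClosed_univ
    · rw [hk]; infer_instance
    · rw [hr]; infer_instance
    · rw [hk]; exact Submodule.closedComplemented_bot
  · rw [pairIndex, fredholmIndex, hk, hr, finrank_bot]
    simp [Module.finrank_zero_of_subsingleton]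

end Projections

/-! ### Diagonal operators and coordinate projections -/

section Diagonal

open Complex
open scoped InnerProductSpace

variable {H : Type*} [NormedAddCommGroup H] [InnerProductSpace ℂ H]

theorem _root_.HilbertBasis.ext_clm {ι F : Type*} [NormedAddCommGroup F] [NormedSpace ℂ F]
    (e : HilbertBasis ι ℂ H) {S T : H →L[ℂ] F} (h : ∀ n, S (e n) = T (e n)) : S = T :=
  ContinuousLinearMap.ext_on (Submodule.dense_iff_topologicalClosure_eq_top.2 e.dense_span)
    (by rintro _ ⟨n, rfl⟩; exact h n)

theorem inner_apply_of_diagonal (e : HilbertBasis ℕ ℂ H) {T : H →L[ℂ] H} {m : ℕ → ℂ}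
    (hT : ∀ n, T (e n) = m n • e n) (n : ℕ) (v : H) : ⟪e n, T v⟫_ℂ = m n * ⟪e n, v⟫_ℂ := by
  have : (innerSL ℂ (e n)) ∘L T = m n • innerSL ℂ (e n) := by
    refine e.ext_clm fun k => ?_
    by_cases hk : n = k
    · subst hk; simp [hT]
    · simp [hT, orthonormal_iff_ite.1 e.orthonormal n k, hk]
  exact congr($this v)

theorem _root_.HilbertBasis.hasSum_norm_inner_sq {ι : Type*} (e : HilbertBasis ι ℂ H) (v : H) :
    HasSum (fun n => ‖⟪e n, v⟫_ℂ‖ ^ 2) (‖v‖ ^ 2) := by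
  have h := (e.hasSum_inner_mul_inner v v).mapL Complex.reCLM
  convert h using 1
  · ext n
    rw [← inner_conj_symm v (e n), Complex.reCLM_apply, ← Complex.normSq_eq_conj_mul_self,
      Complex.ofReal_re, Complex.normSq_eq_norm_sq]
  · rw [inner_self_eq_norm_sq_to_K]; norm_cast

variable [CompleteSpace H]

/-- Parseval bounds `T` below, so its range is closed; the range contains every basis vector, hence
is everything. -/
theorem isUnit_of_diagonal (e : HilbertBasis ℕ ℂ H) {T : H →L[ℂ] H} {m : ℕ → ℂ}
    (hT : ∀ n, T (e n) = m n • e n) {c : ℝ} (hc : 0 < c) (hm : ∀ n, c ≤ ‖m n‖) : IsUnit T := by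
  have hbound : ∀ v, ‖v‖ ≤ c⁻¹ * ‖T v‖ := fun v => by
    have h1 := (e.hasSum_norm_inner_sq v).mul_left (c ^ 2)
    have h2 := e.hasSum_norm_inner_sq (T v)
    have h3 : c ^ 2 * ‖v‖ ^ 2 ≤ ‖T v‖ ^ 2 := by
      refine hasSum_le (fun n => ?_) h1 h2
      rw [inner_apply_of_diagonal e hT, norm_mul, mul_pow]
      gcongr
      exact hm n
    rw [← mul_pow] at h3
    rw [le_inv_mul_iff₀ hc]
    exact le_of_sq_le_sq h3 (norm_nonneg _)
  have hanti : AntilipschitzWith (⟨c, hc.le⟩⁻¹ : NNReal) T :=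
    AddMonoidHomClass.antilipschitz_of_bound T hbound
  have hclosed : IsClosed (T.range : Set H) :=
    (hanti.isClosedEmbedding T.uniformContinuous).isClosed_range
  have hdense : T.range = ⊤ := by
    rw [← hclosed.submodule_topologicalClosure_eq, eq_top_iff, ← e.dense_span]
    refine Submodule.topologicalClosure_mono (Submodule.span_le.2 ?_)
    rintro _ ⟨n, rfl⟩
    have hn : m n ≠ 0 := norm_pos_iff.1 (hc.trans_le (hm n))
    exact ⟨(m n)⁻¹ • e n, by simp [hT, hn]⟩
  exact ContinuousLinearMap.isUnit_iff_bijective.2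
    ⟨hanti.injective, LinearMap.range_eq_top.1 hdense⟩

/-- The orthogonal projection onto the closed span of the basis vectors indexed by `S`. -/
noncomputable def coordProj (e : HilbertBasis ℕ ℂ H) (S : Set ℕ) : H →L[ℂ] H :=
  (Submodule.span ℂ (e '' Sᶜ))ᗮ.starProjection

variable (e : HilbertBasis ℕ ℂ H)

theorem isStarProjection_coordProj (S : Set ℕ) : IsStarProjection (coordProj e S) :=
  isStarProjection_starProjection

theorem coordProj_of_mem {S : Set ℕ} {n : ℕ} (hn : n ∈ S) : coordProj e S (e n) = e n := by
  refine Submodule.starProjection_eq_self_iff.2 ?_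
  rw [Submodule.mem_orthogonal]
  intro u hu
  induction hu using Submodule.span_induction with
  | mem x hx =>
    obtain ⟨k, hk, rfl⟩ := hx
    exact e.orthonormal.2 fun h => hk (h ▸ hn)
  | zero => simp
  | add x y _ _ hx hy => simp [inner_add_left, hx, hy]
  | smul a x _ hx => simp [inner_smul_left, hx]

theorem coordProj_of_notMem {S : Set ℕ} {n : ℕ} (hn : n ∉ S) : coordProj e S (e n) = 0 := by
  refine (Submodule.starProjection_apply_eq_zero_iff _).2 ?_
  exact Submodule.le_orthogonal_orthogonal _ (Submodule.subset_span ⟨n, hn, rfl⟩)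

open Classical in
theorem coordProj_apply_basis (S : Set ℕ) (n : ℕ) :
    coordProj e S (e n) = (if n ∈ S then 1 else 0 : ℂ) • e n := by
  split_ifs with h
  · rw [coordProj_of_mem e h, one_smul]
  · rw [coordProj_of_notMem e h, zero_smul]

theorem isDiagonal_coordProj (S : Set ℕ) : IsDiagonal e (coordProj e S) := by
  classical exact ⟨_, coordProj_apply_basis e S⟩

open Classical in
theorem inner_coordProj (S : Set ℕ) (n : ℕ) (v : H) :
    ⟪e n, coordProj e S v⟫_ℂ = (if n ∈ S then 1 else 0) * ⟪e n, v⟫_ℂ :=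
  inner_apply_of_diagonal e (coordProj_apply_basis e S) n v

theorem coordProj_union {S T : Set ℕ} (h : Disjoint S T) :
    coordProj e (S ∪ T) = coordProj e S + coordProj e T := by
  classical
  refine e.ext_clm fun n => ?_
  simp only [add_apply, coordProj_apply_basis, ← add_smul]
  congr 1
  by_cases hS : n ∈ S
  · simp [hS, Set.disjoint_left.1 h hS]
  · simp [hS]

theorem coordProj_eq_self_iff {S : Set ℕ} {v : H} :
    coordProj e S v = v ↔ ∀ n ∉ S, ⟪e n, v⟫_ℂ = 0 := by
  classical
  constructor
  · intro h n hn
    rw [← h, inner_coordProj, if_neg hn, zero_mul]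
  · intro h
    refine e.repr.injective (lp.ext (funext fun n => ?_))
    rw [e.repr_apply_apply, e.repr_apply_apply, inner_coordProj]
    split_ifs with hn
    · rw [one_mul]
    · rw [h n hn, mul_zero]

theorem coordProj_eq_zero_iff {S : Set ℕ} {v : H} :
    coordProj e S v = 0 ↔ ∀ n ∈ S, ⟪e n, v⟫_ℂ = 0 := by
  classical
  constructor
  · intro h n hn
    have := inner_coordProj e S n v
    rwa [h, inner_zero_right, if_pos hn, one_mul, eq_comm] at this
  · intro h
    refine e.repr.injective (lp.ext (funext fun n => ?_))
    rw [e.repr_apply_apply, inner_coordProj, map_zero]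
    split_ifs with hn
    · rw [h n hn, mul_zero]; rfl
    · rw [zero_mul]; rfl

theorem coordProj_finset (F : Finset ℕ) :
    coordProj e (F : Set ℕ) = ∑ n ∈ F, (innerSL ℂ (e n)).smulRight (e n) := by
  classical
  refine e.ext_clm fun k => ?_
  simp only [coordProj_apply_basis, sum_apply, Finset.mem_coe,
    ContinuousLinearMap.smulRight_apply, innerSL_apply_apply,
    orthonormal_iff_ite.1 e.orthonormal]
  simp

theorem isCompactOperator_coordProj (F : Finset ℕ) :
    IsCompactOperator (coordProj e (F : Set ℕ)) := by
  rw [coordProj_finset]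
  have : ∀ n ∈ F, (innerSL ℂ (e n)).smulRight (e n) ∈ compactOperator (RingHom.id ℂ) H H := by
    intro n _
    have h : IsCompactOperator (innerSL ℂ (e n)) :=
      isCompactOperator_of_locallyCompactSpace_dom (innerSL ℂ (e n))
    exact h.clm_comp ((1 : ℂ →L[ℂ] ℂ).smulRight (e n))
  exact Submodule.sum_mem _ this

/-! ### Rounding to a diagonal projection and finite corrections -/

/-- A projection in `𝒟 + 𝒦` is a compact perturbation of a diagonal projection. -/
theorem exists_isCompactOperator_sub_coordProj {P : H →L[ℂ] H} (hP : IsStarProjection P)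
    (hPmem : P ∈ diagAddCompact e) :
    ∃ S : Set ℕ, IsCompactOperator (P - coordProj e S : H →L[ℂ] H) := by
  classical
  obtain ⟨D, K, ⟨x, hx⟩, hK, rfl⟩ := hPmem
  let S : Set ℕ := {n | 1 / 2 ≤ (x n).re}
  set E := coordProj e S with hE
  refine ⟨S, ?_⟩
  -- The entries of `D - 1 + E` are `x n` or `x n - 1`, whichever the threshold 1/2 keeps away from
  -- 0. As `(E - D)(D - 1 + E) = D - D²`, inverting this factor transfers compactness to `E - D`.
  have hM : ∀ n, (D - 1 + E) (e n) = (if n ∈ S then x n else x n - 1) • e n := by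
    intro n
    simp only [add_apply, sub_apply,
      one_apply_eq_self, hx, hE, coordProj_apply_basis]
    split_ifs <;> module
  have hunit : IsUnit (D - 1 + E) := by
    refine isUnit_of_diagonal e hM (c := 1 / 2) (by norm_num) fun n => ?_
    split_ifs with hn
    · exact (show 1 / 2 ≤ (x n).re from hn).trans (Complex.re_le_norm _)
    · have h1 : (x n).re < 1 / 2 := not_le.1 hn
      have h2 := (neg_le_abs _).trans (Complex.abs_re_le_norm (x n - 1))
      simp only [sub_re, one_re] at h2
      linarith
  have hcomm : (E - D) * (D - 1 + E) = D - D * D := by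
    refine e.ext_clm fun n => ?_
    rw [mul_apply_eq_comp, hM]
    simp only [sub_apply, map_smul, mul_apply_eq_comp, hx, hE,
      coordProj_apply_basis]
    split_ifs <;> module
  have hDD : D - D * D = D * K + K * D + K * K - K := by
    have h : (D + K) * (D + K) = D + K := hP.isIdempotentElem
    rw [add_mul, mul_add, mul_add] at h
    rw [eq_sub_iff_add_eq, sub_add_eq_add_sub, ← h]
    abel
  have hc : IsCompactOperator (D - D * D : H →L[ℂ] H) := by
    rw [hDD]
    exact (((hK.clm_comp D).add (hK.comp_clm D)).add (hK.comp_clm K)).sub hK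
  obtain ⟨u, hu⟩ := hunit
  have hED : E - D = (D - D * D) * (↑u⁻¹ : H →L[ℂ] H) := by
    rw [← hcomm, ← hu, Units.mul_inv_cancel_right]
  have : D + K - E = K - (D - D * D) * (↑u⁻¹ : H →L[ℂ] H) := by
    rw [← hED]; abel
  rw [this]
  exact hK.sub (hc.comp_clm (↑u⁻¹ : H →L[ℂ] H))

omit [CompleteSpace H] in
/-- If the coordinates indexed by `S` separate the points of a finite-dimensional subspace, then
so do finitely many of them that are linearly independent on it. -/
theorem exists_finset_separating (V : Submodule ℂ H) [FiniteDimensional ℂ V] (S : Set ℕ)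
    (hV : ∀ v ∈ V, (∀ n ∈ S, ⟪e n, v⟫_ℂ = 0) → v = 0) :
    ∃ F : Finset ℕ, (F : Set ℕ) ⊆ S ∧ (∀ v ∈ V, (∀ n ∈ F, ⟪e n, v⟫_ℂ = 0) → v = 0) ∧
      ∀ c : ℕ → ℂ, (∀ v ∈ V, ∑ n ∈ F, c n * ⟪e n, v⟫_ℂ = 0) → ∀ n ∈ F, c n = 0 := by
  classical
  let φ : S → Module.Dual ℂ V := fun n => (innerSL ℂ (e n)).toLinearMap ∘ₗ V.subtype
  -- An independent subfamily with the same span; it is finite because the dual of `V` is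
  -- finite-dimensional.
  obtain ⟨κ, a, ha, hspan, hli⟩ := exists_linearIndependent' ℂ φ
  have : Finite κ := hli.finite
  have : Fintype κ := Fintype.ofFinite κ
  have hinj : Function.Injective fun k => (a k : ℕ) := Subtype.val_injective.comp ha
  refine ⟨Finset.univ.map ⟨_, hinj⟩, ?_, ?_, ?_⟩
  · intro n hn
    obtain ⟨k, -, rfl⟩ := Finset.mem_map.1 (Finset.mem_coe.1 hn)
    exact (a k).2
  · intro v hv h
    refine hV v hv fun n hn => ?_
    have hle : Submodule.span ℂ (Set.range (φ ∘ a)) ≤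
        LinearMap.ker (Module.Dual.eval ℂ V ⟨v, hv⟩) := by
      rw [Submodule.span_le]
      rintro _ ⟨k, rfl⟩
      exact h (a k) (Finset.mem_map.2 ⟨k, Finset.mem_univ _, rfl⟩)
    rw [hspan] at hle
    exact hle (Submodule.subset_span ⟨⟨n, hn⟩, rfl⟩)
  · intro c hc n hn
    obtain ⟨k, -, rfl⟩ := Finset.mem_map.1 hn
    refine Fintype.linearIndependent_iff.1 hli (fun k => c (a k)) ?_ k
    ext v
    have := hc v v.2
    rw [Finset.sum_map] at this
    simpa [φ] using this

theorem finiteDimensional_of_isCompactOperator {T : H →L[ℂ] H} (hT : IsCompactOperator T) {μ : ℂ}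
    (hμ : μ ≠ 0) (V : Submodule ℂ H) (hV : ∀ v ∈ V, T v = μ • v) : FiniteDimensional ℂ V := by
  have := ContinuousLinearMap.finite_dimensional_eigenspace hT μ hμ
  exact Submodule.finiteDimensional_of_le (S₂ := Module.End.eigenspace T.toLinearMap μ)
    fun v hv => Module.End.mem_eigenspace_iff.2 (hV v hv)

/-- A finite change of the index set brings the diagonal projection into general position. -/
theorem exists_coordProj_generic {P : H →L[ℂ] H} (hP : IsStarProjection P) {S : Set ℕ}
    (hS : IsCompactOperator (P - coordProj e S : H →L[ℂ] H)) :
    ∃ T : Set ℕ, IsCompactOperator (P - coordProj e T : H →L[ℂ] H) ∧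
      (∀ x, P x = x → coordProj e T x = 0 → x = 0) ∧
      (∀ x, coordProj e T x = x → P x = 0 → x = 0) := by
  classical
  -- Removing a finite `F` from `S` that separates `N(P) ∩ R(E)` makes this intersection trivial.
  let W : Submodule ℂ H := LinearMap.ker P.toLinearMap ⊓
    LinearMap.eqLocus (coordProj e S).toLinearMap LinearMap.id
  have hW : ∀ {v}, v ∈ W ↔ P v = 0 ∧ coordProj e S v = v := Iff.rfl
  have : FiniteDimensional ℂ W := finiteDimensional_of_isCompactOperator hS (μ := -1) (by simp) W
    fun v hv => by simp [(hW.1 hv).1, (hW.1 hv).2]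
  obtain ⟨F, hFS, hF, -⟩ := exists_finset_separating e W S fun v hv h => by
    rw [← (hW.1 hv).2]; exact (coordProj_eq_zero_iff e).2 h
  have hS' : coordProj e S = coordProj e (S \ F) + coordProj e (F : Set ℕ) := by
    rw [← coordProj_union e Set.disjoint_sdiff_left, Set.sdiff_union_of_subset hFS]
  have hc' : IsCompactOperator (P - coordProj e (S \ F) : H →L[ℂ] H) := by
    have : P - coordProj e (S \ F) = (P - coordProj e S) + coordProj e (F : Set ℕ) := by
      rw [hS']; abel
    rw [this]
    exact hS.add (isCompactOperator_coordProj e F)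
  have hker : ∀ x, coordProj e (S \ F) x = x → P x = 0 → x = 0 := by
    intro x hx hPx
    rw [coordProj_eq_self_iff] at hx
    refine hF x (hW.2 ⟨hPx, (coordProj_eq_self_iff e).2 fun n hn => hx n fun h => hn h.1⟩)
      fun n hn => hx n fun h => h.2 hn
  -- What remains of `R(P) ∩ N(E)` is killed by adding a finite `G`. Its independence on `V` keeps
  -- the first intersection trivial.
  let V : Submodule ℂ H := LinearMap.ker (coordProj e (S \ F)).toLinearMap ⊓
    LinearMap.eqLocus P.toLinearMap LinearMap.id
  have hV : ∀ {v}, v ∈ V ↔ coordProj e (S \ F) v = 0 ∧ P v = v := Iff.rfl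
  have : FiniteDimensional ℂ V := finiteDimensional_of_isCompactOperator hc' (μ := 1) (by simp) V
    fun v hv => by simp [(hV.1 hv).1, (hV.1 hv).2]
  obtain ⟨G, hGS, hG, hGli⟩ := exists_finset_separating e V (S \ F)ᶜ fun v hv h => by
    rw [← (coordProj_eq_self_iff e).2 h, (hV.1 hv).1]
  have hdisj : Disjoint (S \ F) (G : Set ℕ) := Set.disjoint_left.2 fun n hn hnG => hGS hnG hn
  have hU := coordProj_union e hdisj
  refine ⟨S \ F ∪ G, ?_, ?_, ?_⟩
  · rw [hU, ← sub_sub]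
    exact hc'.sub (isCompactOperator_coordProj e G)
  · intro x hPx hx
    rw [coordProj_eq_zero_iff] at hx
    exact hG x (hV.2 ⟨(coordProj_eq_zero_iff e).2 fun n hn => hx n (Or.inl hn), hPx⟩)
      fun n hn => hx n (Or.inr hn)
  · intro y hy hPy
    -- Both `y` and its `S \ F` part are orthogonal to `V`, hence so is its `G` part. This is a
    -- linear relation on `V` among the independent `G` coordinates, with coefficients the
    -- conjugates of those of `y`.
    have hGy : ∀ n ∈ G, ⟪e n, y⟫_ℂ = 0 := by
      have := hGli (fun n => starRingEnd ℂ ⟪e n, y⟫_ℂ) fun v hv => ?_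
      · exact fun n hn => (map_eq_zero _).1 (this n hn)
      have hPs : (P : H →ₗ[ℂ] H).IsSymmetric := hP.isSelfAdjoint.isSymmetric
      have hEs : (coordProj e (S \ F) : H →ₗ[ℂ] H).IsSymmetric :=
        (isStarProjection_coordProj e _).isSelfAdjoint.isSymmetric
      have h0 : ⟪y, v⟫_ℂ = 0 := by
        have := hPs y v
        simpa [(hV.1 hv).2, hPy] using this.symm
      have h1 : ⟪coordProj e (S \ F) y, v⟫_ℂ = 0 := by
        have := hEs y v
        simpa [(hV.1 hv).1] using this
      rw [← hy, hU, add_apply, inner_add_left, h1, zero_add,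
        coordProj_finset, sum_apply, sum_inner] at h0
      simpa [inner_smul_left] using h0
    refine hker y ((coordProj_eq_self_iff e).2 fun n hn => ?_) hPy
    by_cases hnG : n ∈ G
    · exact hGy n hnG
    · refine (coordProj_eq_self_iff e).1 hy n fun h => ?_
      rcases h with h | h
      exacts [hn h, hnG h]

end Diagonal

end DiagPlusCompact

open DiagPlusCompact in
theorem mainTheorem1 {H : Type*} [NormedAddCommGroup H] [InnerProductSpace ℂ H] [CompleteSpace H]
    (e : HilbertBasis ℕ ℂ H) (P : H →L[ℂ] H) (hP : IsStarProjection P)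
    (hPmem : P ∈ DiagPlusCompact.diagAddCompact e) :
    ∃ E₀ : H →L[ℂ] H,
      IsStarProjection E₀ ∧ DiagPlusCompact.IsDiagonal e E₀ ∧
      IsCompactOperator (P - E₀ : H →L[ℂ] H) ∧
      DiagPlusCompact.IsFredholmPair P E₀ ∧ DiagPlusCompact.pairIndex P E₀ = 0 ∧
      ∃ U : H →L[ℂ] H,
        U ∈ unitary (H →L[ℂ] H) ∧
        IsCompactOperator (U - 1 : H →L[ℂ] H) ∧
        (∃ X : H →L[ℂ] H, IsSelfAdjoint X ∧ IsCompactOperator X ∧ ‖X‖ ≤ π ∧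
          U = NormedSpace.exp (Complex.I • X)) ∧
        U ∈ DiagPlusCompact.diagAddCompact e ∧
        U * E₀ * star U = P := by
  obtain ⟨S, hS⟩ := exists_isCompactOperator_sub_coordProj e hP hPmem
  obtain ⟨T, hc, h₁, h₂⟩ := exists_coordProj_generic e hP hS
  have hE := isStarProjection_coordProj e T
  obtain ⟨hVc, hV1⟩ := neg_one_notMem_spectrum hP hE hc h₁ h₂
  obtain ⟨hF, hi⟩ := isFredholmPair_of_bijective hP hE
    (bijective_pairOperator hP hE (isUnit_add_sub_one hE hV1))
  have hVu := mul_mem (two_smul_sub_one_mem_unitary hP) (two_smul_sub_one_mem_unitary hE)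
  have hs := (Unitary.spectrum_subset_slitPlane_iff_norm_lt_two hVu).2
    ((Unitary.norm_sub_one_lt_two_iff hVu).2 hV1)
  obtain ⟨hX, hXn, hU, hUE⟩ := conj_exp_half_cfc_arg hP hE rfl hs rfl rfl
  have hXc := (isCompactOperator_cfc_arg hVu hVc hs).smul_clm (2⁻¹ : ℂ)
  have hUc := isCompactOperator_exp_sub_one (hXc.smul_clm Complex.I)
  exact ⟨coordProj e T, hE, isDiagonal_coordProj e T, hc, hF, hi, _, hU, hUc,
    ⟨_, hX, hXc, hXn, rfl⟩, ⟨1, _, ⟨fun _ => 1, by simp⟩, hUc, by abel⟩, hUE⟩
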